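/- Let $(\Omega,\mathcal F,\mathbb P)$ be a complete probability space with a filtration $(\mathcal F_t)_{t\ge 0}$ satisfying the usual conditions (it is right continuous, and $\mathcal F_0$ contains all subsets of $\mathbb P$-null sets of $\mathcal F$), and let $L^0(\Omega,\mathcal F,\mathbb P)$ be the space of classes of real random variables modulo $\mathbb P$-a.e. equality, with the topology of convergence in probability. Let $H$ and $G$ be separable real Hilbert spaces and let $T>0$. Let $M=(M_t)_{t\in[0,T]}$ be a cylindrical square integrable martingale in $H$, i.e. each $M_t:H\to L^0(\Omega,\mathcal F,\mathbb P)$ is linear and, for every $h\in H$, $(M_t(h))_{t\in[0,T]}$ is a real-valued square integrable martingale with respect to $(\mathcal F_t)_{t\in[0,T]}$. Assume that for each $t\in[0,T]$ the map $M_t:H\to L^0(\Omega,\mathcal F,\mathbb P)$ is continuous. Let $S:H\to G$ be a Hilbert--Schmidt operator, i.e. a continuous linear operator with $\sum_n\|Sh_n\|^2<\infty$ for some (equivalently, any) complete orthonormal system $(h_n)$ of $H$, and let $S^*:G\to H$ be its adjoint. Then $M\circ S^*=(M_t\circ S^*)_{t\in[0,T]}$ is a cylindrical square integrable martingale in $G$,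 and it has a $G$-valued càdlàg version that is a square integrable martingale: there is a $G$-valued process $X=(X_t)_{t\in[0,T]}$ with càdlàg paths which is a martingale with respect to $(\mathcal F_t)_{t\in[0,T]}$, satisfies $\mathbb E\|X_t\|^2<\infty$ for all $t\in[0,T]$, and is such that for every $t\in[0,T]$ and $g\in G$, $\langle X_t,g\rangle=M_t(S^*g)$ $\mathbb P$-a.e. -/

import Mathlib

open MeasureTheory Filter Topology
open scoped NNReal ENNReal

universe u

/-- The usual conditions: the filtration is right continuous and `𝓕 0` contains every subset of
an event of probability zero (`P s = 0` for an arbitrary set `s` says that `s` is contained in a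
measurable null set). -/
structure UsualConditions {Ω : Type*} {m : MeasurableSpace Ω} (𝓕 : Filtration ℝ≥0 m)
    (P : Measure Ω) : Prop where
  rightContinuous : 𝓕.IsRightContinuous
  null_measurable : ∀ s : Set Ω, P s = 0 → MeasurableSet[𝓕 0] s

/-- The restriction to the time interval `[0,T]` of a filtration indexed by `[0,∞)`. -/
def MeasureTheory.Filtration.restrictIcc {Ω : Type*} {m : MeasurableSpace Ω}
    (𝓕 : Filtration ℝ≥0 m) (T : ℝ≥0) : Filtration (Set.Icc (0 : ℝ≥0) T) m where
  seq t := 𝓕 t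
  mono' _ _ h := 𝓕.mono h
  le' t := 𝓕.le t

/-- A bounded operator is Hilbert-Schmidt if `∑ ‖S hᵢ‖² < ∞` for some complete orthonormal system
`(hᵢ)` of `H`. -/
def IsHilbertSchmidt {H : Type u} {G : Type*} [NormedAddCommGroup H] [InnerProductSpace ℝ H]
    [NormedAddCommGroup G] [InnerProductSpace ℝ G] (S : H →L[ℝ] G) : Prop :=
  ∃ (ι : Type u) (b : HilbertBasis ι ℝ H), Summable fun i => ‖S (b i)‖ ^ 2

/-- A square integrable martingale with values in a Banach space. -/
def IsSquareIntegrableMartingale {Ω J E : Type*} [Preorder J] {m : MeasurableSpace Ω}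
    [NormedAddCommGroup E] [NormedSpace ℝ E] [CompleteSpace E]
    (X : J → Ω → E) (𝓕 : Filtration J m) (P : Measure Ω) : Prop :=
  Martingale X 𝓕 P ∧ ∀ t, MemLp (X t) 2 P

/-- A path is càdlàg if it is right continuous and has left limits
(at a point without points to its left the second condition is void). -/
def IsCadlagPath {J E : Type*} [Preorder J] [TopologicalSpace J] [TopologicalSpace E]
    (f : J → E) : Prop :=
  ∀ t, ContinuousWithinAt f (Set.Ici t) t ∧ ∃ l, Tendsto f (𝓝[<] t) (𝓝 l)

/-- A cylindrical random variable in `H`: a linear map from `H` into the space `L⁰(Ω, P)` of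
classes of real random variables modulo almost sure equality. -/
abbrev CylindricalRV {Ω : Type*} [MeasurableSpace Ω] (H : Type*) [NormedAddCommGroup H]
    [InnerProductSpace ℝ H] (P : Measure Ω) : Type _ :=
  H →ₗ[ℝ] (Ω →ₘ[P] ℝ)

/-- Continuity of a cylindrical random variable `H → L⁰(Ω, P)`, where `L⁰` carries the topology
of convergence in probability. -/
def CylindricalRV.IsContinuous {Ω : Type*} [MeasurableSpace Ω] {H : Type*} [NormedAddCommGroup H]
    [InnerProductSpace ℝ H] {P : Measure Ω} (Y : CylindricalRV H P) : Prop :=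
  ∀ h : H, TendstoInMeasure P (fun (h' : H) (ω : Ω) => Y h' ω) (𝓝 h) (fun ω => Y h ω)

/-- A cylindrical square integrable martingale: for every `h`, the real process `(M t h)` is a
square integrable martingale. (When the σ-algebras of the filtration contain all null sets, this
does not depend on the representatives of the classes `M t h`.) -/
def IsCylindricalSquareIntegrableMartingale {Ω J H : Type*} [Preorder J] {m : MeasurableSpace Ω}
    [NormedAddCommGroup H] [InnerProductSpace ℝ H] {P : Measure Ω}
    (M : J → CylindricalRV H P) (𝓕 : Filtration J m) : Prop :=
  ∀ h : H, IsSquareIntegrableMartingale (fun (t : J) (ω : Ω) => M t h ω) 𝓕 P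

/-- The cylindrical process `M ∘ S* = (M t ∘ S*)` in `G`. -/
noncomputable def cylindricalCompAdjoint {Ω J H G : Type*} [MeasurableSpace Ω]
    [NormedAddCommGroup H] [InnerProductSpace ℝ H] [CompleteSpace H]
    [NormedAddCommGroup G] [InnerProductSpace ℝ G] [CompleteSpace G] {P : Measure Ω}
    (M : J → CylindricalRV H P) (S : H →L[ℝ] G) : J → CylindricalRV G P :=
  fun t => (M t).comp (ContinuousLinearMap.adjoint S : G →L[ℝ] H).toLinearMap

/-- The `G`-valued process `X` is a version of the cylindrical process `Y` in `G`:
for all `t` and `g`, almost surely `⟨X t, g⟩ = Y t g`. -/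
def IsVersionOf {Ω J G : Type*} [MeasurableSpace Ω] [NormedAddCommGroup G]
    [InnerProductSpace ℝ G] {P : Measure Ω}
    (X : J → Ω → G) (Y : J → CylindricalRV G P) : Prop :=
  ∀ (t : J) (g : G), ∀ᵐ ω ∂P, inner ℝ (X t ω) g = Y t g ω

/-! The whole process is encoded in its terminal value, since M_t(h) = E[M_T(h) | F_t]. It therefore
suffices to find a square integrable G-valued Z with ⟨Z, g⟩ = M_T(S*g) a.s. for each g, and to
choose a càdlàg version of E[Z | F_t]: conditional expectation commutes with ⟨·, g⟩.

Existence of Z: by the closed graph theorem M_T is a bounded operator B from H to L²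
(`CylindricalRV.IsContinuous.exists_clm_lp`). As S* is Hilbert-Schmidt, ∑ ‖B S* b_k‖² is finite for
an orthonormal basis (b_k) of G, and Z = ∑ (B S* b_k) b_k converges in L²(Ω; G)
(`exists_lp_inner_eq_of_summable_norm_sq`).

Càdlàg version (`exists_cadlag_modification_condExp`): in G there is no order, so upcrossings are
replaced by displacements of size δ. Orthogonality of martingale increments bounds their expected
number by a multiple of the second moment, uniformly over finite sets of times
(`MeasureTheory.Martingale.integral_greedyRecord_le`). Almost every path thus oscillates boundedly
often along a countable dense set of times, so one-sided limits along that set exist, and the right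
limits form a càdlàg path. The usual conditions make them adapted, and uniform integrability
identifies them with E[Z | F_t]. -/

/-! ### Oscillations of a path. -/

/-- `OscillatesFrom f δ A n l`: from time `l` on there are `n` consecutive, non-overlapping
intervals with endpoints in `A`, along each of which `f` moves by at least `δ`. -/
def OscillatesFrom {J E : Type*} [Preorder J] [PseudoMetricSpace E] (f : J → E) (δ : ℝ)
    (A : Set J) : ℕ → J → Prop
  | 0, _ => True
  | n + 1, l => ∃ a ∈ A, ∃ b ∈ A, l ≤ a ∧ a < b ∧ δ ≤ dist (f a) (f b) ∧
      OscillatesFrom f δ A n b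

namespace OscillatesFrom

variable {J E : Type*} [Preorder J] [PseudoMetricSpace E] {f : J → E} {δ : ℝ} {A B : Set J}

theorem anti {n : ℕ} {k l : J} (hkl : k ≤ l) (h : OscillatesFrom f δ A n l) :
    OscillatesFrom f δ A n k := by
  cases n with
  | zero => trivial
  | succ n =>
    obtain ⟨a, ha, b, hb, hla, h⟩ := h
    exact ⟨a, ha, b, hb, hkl.trans hla, h⟩

theorem mono (hAB : A ⊆ B) {n : ℕ} {l : J} (h : OscillatesFrom f δ A n l) :
    OscillatesFrom f δ B n l := by
  induction n generalizing l with
  | zero => trivial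
  | succ n ih =>
    obtain ⟨a, ha, b, hb, hla, hab, hd, h⟩ := h
    exact ⟨a, hAB ha, b, hAB hb, hla, hab, hd, ih h⟩

/-- Only the 2n endpoints matter. This reduces countable sets of times to finite ones. -/
theorem exists_finset {n : ℕ} {l : J} (h : OscillatesFrom f δ A n l) :
    ∃ F : Finset A, OscillatesFrom f δ (Subtype.val '' (F : Set A)) n l := by
  classical
  induction n generalizing l with
  | zero => exact ⟨∅, trivial⟩
  | succ n ih =>
    obtain ⟨a, ha, b, hb, hla, hab, hd, h⟩ := h
    obtain ⟨F, hF⟩ := ih h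
    refine ⟨insert ⟨a, ha⟩ (insert ⟨b, hb⟩ F), a, ⟨⟨a, ha⟩, by simp, rfl⟩, b,
      ⟨⟨b, hb⟩, by simp, rfl⟩, hla, hab, hd, hF.mono ?_⟩
    refine Set.image_mono fun x hx => ?_
    simp only [Finset.coe_insert, Set.mem_insert_iff]
    exact Or.inr (Or.inr hx)

/-- Oscillations on a finite set of times, seen through an increasing enumeration. -/
theorem comp_strictMonoOn {J : Type*} [LinearOrder J] {f : J → E} {A : Set J} {N : ℕ} {τ : ℕ → J}
    (hτ : StrictMonoOn τ (Set.Iic N)) (hA : A ⊆ τ '' Set.Iic N) {n k : ℕ} (hk : k ≤ N) {l : J}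
    (hl : τ k ≤ l) (h : OscillatesFrom f δ A n l) :
    OscillatesFrom (fun i => f (τ i)) δ (Set.Iic N) n k := by
  induction n generalizing k l with
  | zero => trivial
  | succ n ih =>
    obtain ⟨a, ha, b, hb, hla, hab, hd, h⟩ := h
    obtain ⟨i, hi, rfl⟩ := hA ha
    obtain ⟨j, hj, rfl⟩ := hA hb
    exact ⟨i, hi, j, hj, (hτ.le_iff_le hk hi).1 (hl.trans hla), (hτ.lt_iff_lt hi hj).1 hab, hd,
      ih hj le_rfl h⟩

end OscillatesFrom

/-! ### One-sided limits along a dense set, and càdlàg paths. -/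

section Paths

variable {J E : Type*} [LinearOrder J] [TopologicalSpace J] [OrderTopology J]

theorem Dense.nhdsWithin_Ioi_inter_neBot [DenselyOrdered J] {D : Set J} (hD : Dense D)
    {t : J} (ht : ∃ u, t < u) : (𝓝[Set.Ioi t ∩ D] t).NeBot := by
  rw [← mem_closure_iff_nhdsWithin_neBot]
  refine closure_minimal (hD.open_subset_closure_inter isOpen_Ioi) isClosed_closure ?_
  rw [closure_Ioi' ht]
  exact Set.self_mem_Ici

variable [PseudoMetricSpace E]

/-- If the Cauchy property failed for some ε, there would be ε-displacements arbitrarily close to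
`t` on its right. Placing each new one to the left of those already found yields any number of
consecutive ones; the starting point `p` moves down towards `t`. -/
theorem cauchy_map_nhdsGT_inter {f : J → E} {D : Set J}
    (hf : ∀ δ > 0, ∃ n, ∀ l, ¬ OscillatesFrom f δ D n l) {t : J}
    [h : (𝓝[Set.Ioi t ∩ D] t).NeBot] : Cauchy (map f (𝓝[Set.Ioi t ∩ D] t)) := by
  rw [Metric.cauchy_iff]
  refine ⟨inferInstance, fun ε hε => ?_⟩
  obtain ⟨n, hn⟩ := hf ε hε
  obtain ⟨u₀, hu₀, -⟩ : (Set.Ioi t ∩ D).Nonempty := h.nonempty_of_mem self_mem_nhdsWithin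
  by_contra! H
  have key : ∀ p, t < p → ∃ a ∈ D, ∃ b ∈ D, t < a ∧ a < b ∧ b < p ∧ ε ≤ dist (f a) (f b) := by
    intro p hp
    obtain ⟨_, ⟨a, ha, rfl⟩, _, ⟨b, hb, rfl⟩, hab⟩ := H (f '' (Set.Ioi t ∩ D ∩ Set.Iio p))
      (image_mem_map (inter_mem self_mem_nhdsWithin
        (mem_nhdsWithin_of_mem_nhds (Iio_mem_nhds hp))))
    rcases lt_trichotomy a b with h | rfl | h
    · exact ⟨a, ha.1.2, b, hb.1.2, ha.1.1, h, hb.2, hab⟩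
    · rw [dist_self] at hab; exact absurd hab hε.not_ge
    · exact ⟨b, hb.1.2, a, ha.1.2, hb.1.1, h, ha.2, by rwa [dist_comm]⟩
  have : ∀ n, ∃ p, t < p ∧ OscillatesFrom f ε D n p := by
    intro n
    induction n with
    | zero => exact ⟨u₀, hu₀, trivial⟩
    | succ n ih =>
      obtain ⟨p, hp, h⟩ := ih
      obtain ⟨a, ha, b, hb, hta, hab, hbp, hd⟩ := key p hp
      exact ⟨a, hta, a, ha, b, hb, le_rfl, hab, hd, h.anti hbp.le⟩
  obtain ⟨p, -, hp⟩ := this n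
  exact hn p hp

/-- As on the right, but displacements are now found after any given `p < t`, so the induction runs
over all such `p` at once. -/
theorem cauchy_map_nhdsLT_inter {f : J → E} {D : Set J}
    (hf : ∀ δ > 0, ∃ n, ∀ l, ¬ OscillatesFrom f δ D n l) {t : J}
    [h : (𝓝[Set.Iio t ∩ D] t).NeBot] : Cauchy (map f (𝓝[Set.Iio t ∩ D] t)) := by
  rw [Metric.cauchy_iff]
  refine ⟨inferInstance, fun ε hε => ?_⟩
  obtain ⟨n, hn⟩ := hf ε hε
  obtain ⟨u₀, hu₀, -⟩ : (Set.Iio t ∩ D).Nonempty := h.nonempty_of_mem self_mem_nhdsWithin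
  by_contra! H
  have key : ∀ p, p < t → ∃ a ∈ D, ∃ b ∈ D, p < a ∧ a < b ∧ b < t ∧ ε ≤ dist (f a) (f b) := by
    intro p hp
    obtain ⟨_, ⟨a, ha, rfl⟩, _, ⟨b, hb, rfl⟩, hab⟩ := H (f '' (Set.Iio t ∩ D ∩ Set.Ioi p))
      (image_mem_map (inter_mem self_mem_nhdsWithin
        (mem_nhdsWithin_of_mem_nhds (Ioi_mem_nhds hp))))
    rcases lt_trichotomy a b with h | rfl | h
    · exact ⟨a, ha.1.2, b, hb.1.2, ha.2, h, hb.1.1, hab⟩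
    · rw [dist_self] at hab; exact absurd hab hε.not_ge
    · exact ⟨b, hb.1.2, a, ha.1.2, hb.2, h, ha.1.1, by rwa [dist_comm]⟩
  have : ∀ n, ∀ p < t, OscillatesFrom f ε D n p := by
    intro n
    induction n with
    | zero => exact fun _ _ => trivial
    | succ n ih =>
      intro p hp
      obtain ⟨a, ha, b, hb, hta, hab, hbp, hd⟩ := key p hp
      exact ⟨a, ha, b, hb, hta.le, hab, hd, ih b hbp⟩
  exact hn u₀ (this n u₀ hu₀)

variable [DenselyOrdered J]

theorem mem_of_tendsto_nhdsGT_inter {f r : J → E} {D : Set J} (hD : Dense D)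
    (hr : ∀ t, (∃ u, t < u) → Tendsto f (𝓝[Set.Ioi t ∩ D] t) (𝓝 (r t)))
    {O : Set J} (hO : IsOpen O) {V : Set E} (hV : IsClosed V) (hf : ∀ s ∈ O ∩ D, f s ∈ V)
    {s : J} (hs : s ∈ O) (hs' : ∃ u, s < u) : r s ∈ V := by
  have := hD.nhdsWithin_Ioi_inter_neBot hs'
  refine hV.mem_of_tendsto (hr s hs') ?_
  filter_upwards [self_mem_nhdsWithin, mem_nhdsWithin_of_mem_nhds (hO.mem_nhds hs)] with x hx hxO
  exact hf x ⟨hxO, hx.2⟩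

/-- The right limits of a function along a dense set form a càdlàg path. -/
theorem isCadlagPath_of_tendsto_nhdsGT_inter {f r : J → E} {D : Set J} (hD : Dense D)
    (hr : ∀ t, (∃ u, t < u) → Tendsto f (𝓝[Set.Ioi t ∩ D] t) (𝓝 (r t)))
    (hl : ∀ t, ∃ l, Tendsto f (𝓝[Set.Iio t ∩ D] t) (𝓝 l)) : IsCadlagPath r := by
  intro t
  constructor
  · rw [← continuousWithinAt_Ioi_iff_Ici]
    by_cases ht : ∃ u, t < u
    · refine (closed_nhds_basis (r t)).tendsto_right_iff.2 fun V hV => ?_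
      have h := hr t ht hV.1
      obtain ⟨u, hu, h⟩ := (mem_nhdsGT_iff_exists_Ioo_subset' ht.choose_spec).1
        (show {s | s ∈ D → f s ∈ V} ∈ 𝓝[>] t by
          rw [mem_map, mem_nhdsWithin_iff_eventually] at h
          rw [mem_nhdsWithin_iff_eventually]
          filter_upwards [h] with x hx hx1 hx2 using hx ⟨hx1, hx2⟩)
      filter_upwards [Ioo_mem_nhdsGT hu] with s hs
      exact mem_of_tendsto_nhdsGT_inter hD hr isOpen_Ioo hV.2 (fun x hx => h hx.1 hx.2) hs ⟨u, hs.2⟩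
    · have : Set.Ioi t = ∅ := by
        ext x; simpa using fun h => ht ⟨x, h⟩
      simp [ContinuousWithinAt, this]
  · obtain ⟨l, hl⟩ := hl t
    refine ⟨l, ?_⟩
    by_cases ht : ∃ u, u < t
    · refine (closed_nhds_basis l).tendsto_right_iff.2 fun V hV => ?_
      have h := hl hV.1
      obtain ⟨u, hu, h⟩ := (mem_nhdsLT_iff_exists_Ioo_subset' ht.choose_spec).1
        (show {s | s ∈ D → f s ∈ V} ∈ 𝓝[<] t by
          rw [mem_map, mem_nhdsWithin_iff_eventually] at h
          rw [mem_nhdsWithin_iff_eventually]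
          filter_upwards [h] with x hx hx1 hx2 using hx ⟨hx1, hx2⟩)
      filter_upwards [Ioo_mem_nhdsLT hu] with s hs
      exact mem_of_tendsto_nhdsGT_inter hD hr isOpen_Ioo hV.2 (fun x hx => h hx.1 hx.2) hs ⟨t, hs.2⟩
    · have : Set.Iio t = ∅ := by
        ext x; simpa using fun h => ht ⟨x, h⟩
      simp [this]

end Paths

/-! ### Greedy counting of oscillations. -/

section Greedy

variable {E : Type*} [PseudoMetricSpace E]

/-- Reading the sequence `x`, a new reference point is recorded as soon as `x` is at distance at
least `ε` from the last one. The result is the last reference point up to time `k`, and the number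
of points recorded after time `0`. -/
noncomputable def greedyRecord (ε : ℝ) (x : ℕ → E) : ℕ → E × ℕ
  | 0 => (x 0, 0)
  | k + 1 => open Classical in
    if ε ≤ dist (x (k + 1)) (greedyRecord ε x k).1 then (x (k + 1), (greedyRecord ε x k).2 + 1)
    else greedyRecord ε x k

theorem dist_greedyRecord_lt {ε : ℝ} (hε : 0 < ε) (x : ℕ → E) (k : ℕ) :
    dist (x k) (greedyRecord ε x k).1 < ε := by
  cases k with
  | zero => simpa [greedyRecord] using hε
  | succ k =>
    rw [greedyRecord]
    split_ifs with h
    · simpa using hε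
    · exact not_le.1 h

theorem greedyRecord_eq_or_lt (ε : ℝ) (x : ℕ → E) {j k : ℕ} (hjk : j ≤ k) :
    (greedyRecord ε x k) = (greedyRecord ε x j) ∨
      (greedyRecord ε x j).2 < (greedyRecord ε x k).2 := by
  induction k, hjk using Nat.le_induction with
  | base => exact Or.inl rfl
  | succ k hjk ih =>
    rw [greedyRecord]
    split_ifs with h
    · right
      rcases ih with ih | ih
      · rw [ih]; exact Nat.lt_succ_self _
      · exact ih.trans (Nat.lt_succ_self _)
    · exact ih

theorem greedyRecord_mono (ε : ℝ) (x : ℕ → E) {j k : ℕ} (hjk : j ≤ k) :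
    (greedyRecord ε x j).2 ≤ (greedyRecord ε x k).2 := by
  rcases greedyRecord_eq_or_lt ε x hjk with h | h
  · rw [h]
  · exact h.le

theorem greedyRecord_le (ε : ℝ) (x : ℕ → E) (k : ℕ) : (greedyRecord ε x k).2 ≤ k := by
  induction k with
  | zero => exact le_rfl
  | succ k ih =>
    rw [greedyRecord]
    split_ifs with h
    · exact Nat.succ_le_succ ih
    · exact ih.trans k.le_succ

/-- Each displacement of size 2ε forces a new record: with an unchanged reference point both
endpoints would lie at distance less than ε from it, contradicting the triangle inequality. -/
theorem OscillatesFrom.add_le_greedyRecord {ε : ℝ} (hε : 0 < ε) {x : ℕ → E} {N n l : ℕ}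
    (hl : l ≤ N) (h : OscillatesFrom x (2 * ε) (Set.Iic N) n l) :
    (greedyRecord ε x l).2 + n ≤ (greedyRecord ε x N).2 := by
  induction n generalizing l with
  | zero => exact greedyRecord_mono ε x hl
  | succ n ih =>
    obtain ⟨a, ha, b, hb, hla, hab, hd, h⟩ := h
    have h1 := ih hb h
    have h2 := greedyRecord_mono ε x hla
    rcases greedyRecord_eq_or_lt ε x hab.le with h3 | h3
    · have h4 := dist_greedyRecord_lt hε x a
      have h5 := dist_greedyRecord_lt hε x b
      rw [h3] at h5
      have := dist_triangle_right (x a) (x b) (greedyRecord ε x a).1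
      linarith
    · omega

end Greedy

/-! ### The oscillation inequality in discrete time. -/

section DiscreteTime

theorem MeasureTheory.MemLp.integrable_inner_two {Ω E : Type*} {m : MeasurableSpace Ω}
    {P : Measure Ω} [NormedAddCommGroup E] [InnerProductSpace ℝ E] {f g : Ω → E} (hf : MemLp f 2 P)
    (hg : MemLp g 2 P) : Integrable (fun ω => inner ℝ (f ω) (g ω)) P := by
  refine ((hf.integrable_norm_pow two_ne_zero).add
    (hg.integrable_norm_pow two_ne_zero)).mono' (hf.1.inner hg.1) (ae_of_all _ fun ω => ?_)
  refine (norm_inner_le_norm _ _).trans ?_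
  simp only [Pi.add_apply]
  nlinarith [sq_nonneg (‖f ω‖ - ‖g ω‖), sq_nonneg (‖f ω‖), sq_nonneg (‖g ω‖)]

variable {Ω E : Type*} {m : MeasurableSpace Ω} {P : Measure Ω} [NormedAddCommGroup E]
  {𝓖 : Filtration ℕ m} {X : ℕ → Ω → E}

theorem stronglyMeasurable_greedyRecord (hX : StronglyAdapted 𝓖 X) (ε : ℝ) (k : ℕ) :
    StronglyMeasurable[𝓖 k] (fun ω => (greedyRecord ε (fun i => X i ω) k).1) ∧
    StronglyMeasurable[𝓖 k] (fun ω => ((greedyRecord ε (fun i => X i ω) k).2 : ℝ)) := by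
  classical
  induction k with
  | zero => exact ⟨hX 0, by simpa only [greedyRecord] using stronglyMeasurable_const⟩
  | succ k ih =>
    have h1 := ih.1.mono (𝓖.mono k.le_succ)
    have h2 := ih.2.mono (𝓖.mono k.le_succ)
    have hs : MeasurableSet[𝓖 (k + 1)]
        {ω | ε ≤ dist (X (k + 1) ω) (greedyRecord ε (fun i => X i ω) k).1} :=
      StronglyMeasurable.measurableSet_le stronglyMeasurable_const ((hX (k + 1)).dist h1)
    constructor
    · have h : StronglyMeasurable[𝓖 (k + 1)] fun ω =>
          if ε ≤ dist (X (k + 1) ω) (greedyRecord ε (fun i => X i ω) k).1 then X (k + 1) ω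
          else (greedyRecord ε (fun i => X i ω) k).1 :=
        StronglyMeasurable.ite hs (hX (k + 1)) h1
      convert! h using 2 with ω
      rw [greedyRecord]
      split_ifs <;> rfl
    · have h : StronglyMeasurable[𝓖 (k + 1)] fun ω =>
          if ε ≤ dist (X (k + 1) ω) (greedyRecord ε (fun i => X i ω) k).1
          then ((greedyRecord ε (fun i => X i ω) k).2 : ℝ) + 1
          else ((greedyRecord ε (fun i => X i ω) k).2 : ℝ) :=
        StronglyMeasurable.ite hs (h2.add stronglyMeasurable_const) h2
      convert! h using 2 with ω
      rw [greedyRecord]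
      split_ifs <;> simp

theorem memLp_greedyRecord (hX : StronglyAdapted 𝓖 X) (hX2 : ∀ k, MemLp (X k) 2 P) (ε : ℝ)
    (k : ℕ) : MemLp (fun ω => (greedyRecord ε (fun i => X i ω) k).1) 2 P := by
  induction k with
  | zero => exact hX2 0
  | succ k ih =>
    refine (((hX2 (k + 1)).norm).add ih.norm).mono
      ((stronglyMeasurable_greedyRecord hX ε (k + 1)).1.mono (𝓖.le _)).aestronglyMeasurable
      (ae_of_all _ fun ω => ?_)
    simp only [Pi.add_apply, Real.norm_eq_abs]
    rw [abs_of_nonneg (by positivity), greedyRecord]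
    split_ifs <;> simp

theorem integrable_greedyRecord [IsFiniteMeasure P] (hX : StronglyAdapted 𝓖 X) (ε : ℝ)
    (k : ℕ) : Integrable (fun ω => ((greedyRecord ε (fun i => X i ω) k).2 : ℝ)) P := by
  refine Integrable.of_bound
    ((stronglyMeasurable_greedyRecord hX ε k).2.mono (𝓖.le _)).aestronglyMeasurable k
    (ae_of_all _ fun ω => ?_)
  simpa using greedyRecord_le ε (fun i => X i ω) k

variable [IsFiniteMeasure P] [InnerProductSpace ℝ E] [CompleteSpace E]

theorem MeasureTheory.Martingale.integral_inner_eq {J : Type*} [Preorder J] {𝓖 : Filtration J m}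
    {X : J → Ω → E} (hX : Martingale X 𝓖 P) {i j : J} (hij : i ≤ j) (hXj : MemLp (X j) 2 P)
    {Y : Ω → E} (hY : StronglyMeasurable[𝓖 i] Y) (hY2 : MemLp Y 2 P) :
    ∫ ω, inner ℝ (X j ω) (Y ω) ∂P = ∫ ω, inner ℝ (X i ω) (Y ω) ∂P := by
  have h := condExp_bilin_of_stronglyMeasurable_right (innerSL ℝ) (f := X j) (m := 𝓖 i)
    (μ := P) hY (hXj.integrable_inner_two hY2) (hX.integrable j)
  rw [← integral_condExp (𝓖.le i)]
  refine integral_congr_ae ?_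
  filter_upwards [h, hX.2 i j hij] with ω h1 h2
  rw [← h2]
  exact h1

/-- On expanding the squares, the cross terms with `Y` agree at times `i` and `j` by the martingale
property, so the gain in second moment does not depend on the known reference point. -/
theorem MeasureTheory.Martingale.integral_norm_sub_sq {J : Type*} [Preorder J]
    {𝓖 : Filtration J m} {X : J → Ω → E} (hX : Martingale X 𝓖 P) {i j : J} (hij : i ≤ j)
    (hXi : MemLp (X i) 2 P) (hXj : MemLp (X j) 2 P)
    {Y : Ω → E} (hY : StronglyMeasurable[𝓖 i] Y) (hY2 : MemLp Y 2 P) :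
    ∫ ω, ‖X j ω - Y ω‖ ^ 2 ∂P - ∫ ω, ‖X i ω - Y ω‖ ^ 2 ∂P
      = ∫ ω, ‖X j ω‖ ^ 2 ∂P - ∫ ω, ‖X i ω‖ ^ 2 ∂P := by
  have key : ∀ k, MemLp (X k) 2 P → ∫ ω, ‖X k ω - Y ω‖ ^ 2 ∂P
      = ∫ ω, ‖X k ω‖ ^ 2 ∂P - 2 * ∫ ω, inner ℝ (X k ω) (Y ω) ∂P + ∫ ω, ‖Y ω‖ ^ 2 ∂P := by
    intro k hk
    have h1 := hk.integrable_norm_pow two_ne_zero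
    have h2 := hY2.integrable_norm_pow two_ne_zero
    have h3 := hk.integrable_inner_two hY2
    simp_rw [norm_sub_sq_real]
    rw [integral_add (f := fun ω => ‖X k ω‖ ^ 2 - 2 * inner ℝ (X k ω) (Y ω))
      (h1.sub (h3.const_mul 2)) h2, integral_sub h1 (h3.const_mul 2),
      integral_const_mul]
  rw [key j hXj, key i hXi, hX.integral_inner_eq hij hXj hY hY2]
  ring

/-- The expected number of `ε`-oscillations of a square integrable martingale. -/
theorem MeasureTheory.Martingale.integral_greedyRecord_le (hX : Martingale X 𝓖 P)
    (hX2 : ∀ k, MemLp (X k) 2 P) {ε : ℝ} (hε : 0 < ε) (k : ℕ) :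
    ε ^ 2 * ∫ ω, ((greedyRecord ε (fun i => X i ω) k).2 : ℝ) ∂P ≤ ∫ ω, ‖X k ω‖ ^ 2 ∂P := by
  -- The squared distance to the current reference point is added so that the induction closes: it
  -- is the energy accumulated towards the next record.
  suffices H : ∫ ω, ‖X k ω - (greedyRecord ε (fun i => X i ω) k).1‖ ^ 2 ∂P
      + ε ^ 2 * ∫ ω, ((greedyRecord ε (fun i => X i ω) k).2 : ℝ) ∂P ≤ ∫ ω, ‖X k ω‖ ^ 2 ∂P by
    have : 0 ≤ ∫ ω, ‖X k ω - (greedyRecord ε (fun i => X i ω) k).1‖ ^ 2 ∂P :=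
      integral_nonneg fun ω => by positivity
    linarith
  induction k with
  | zero =>
    simp only [greedyRecord, sub_self, norm_zero]
    simpa using integral_nonneg fun ω => by positivity
  | succ k ih =>
    have hY := memLp_greedyRecord hX.1 hX2 ε
    have hN := integrable_greedyRecord (P := P) hX.1 ε
    have hQ : ∀ i j, Integrable
        (fun ω => ‖X i ω - (greedyRecord ε (fun i => X i ω) j).1‖ ^ 2) P :=
      fun i j => ((hX2 i).sub (hY j)).integrable_norm_pow two_ne_zero
    have h1 := hX.integral_norm_sub_sq k.le_succ (hX2 k) (hX2 (k + 1))
      (stronglyMeasurable_greedyRecord hX.1 ε k).1 (hY k)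
    -- Pointwise: a new record resets the squared distance, then at least ε², to zero, and this pays
    -- for raising the count by one.
    have h2 : ∫ ω, (‖X (k + 1) ω - (greedyRecord ε (fun i => X i ω) (k + 1)).1‖ ^ 2
          + ε ^ 2 * ((greedyRecord ε (fun i => X i ω) (k + 1)).2 : ℝ)) ∂P
        ≤ ∫ ω, (‖X (k + 1) ω - (greedyRecord ε (fun i => X i ω) k).1‖ ^ 2
          + ε ^ 2 * ((greedyRecord ε (fun i => X i ω) k).2 : ℝ)) ∂P := by
      refine integral_mono ((hQ _ _).add ((hN _).const_mul _))
        ((hQ _ _).add ((hN _).const_mul _)) fun ω => ?_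
      simp only [greedyRecord]
      split_ifs with h
      · rw [dist_eq_norm] at h
        have : ε ^ 2 ≤ ‖X (k + 1) ω - (greedyRecord ε (fun i => X i ω) k).1‖ ^ 2 := by gcongr
        simp only [sub_self, norm_zero, Nat.cast_add, Nat.cast_one]
        linarith
      · exact le_rfl
    rw [integral_add (hQ _ _) ((hN _).const_mul _), integral_add (hQ _ _) ((hN _).const_mul _),
      integral_const_mul, integral_const_mul] at h2
    linarith

/-- Markov's inequality for the record count, which is at least `n` on this event. -/
theorem MeasureTheory.Martingale.measure_oscillatesFrom_Iic_le (hX : Martingale X 𝓖 P)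
    (hX2 : ∀ k, MemLp (X k) 2 P) {ε : ℝ} (hε : 0 < ε) (N : ℕ) {n : ℕ} (hn : n ≠ 0) :
    P {ω | OscillatesFrom (fun i => X i ω) (2 * ε) (Set.Iic N) n 0}
      ≤ ENNReal.ofReal ((∫ ω, ‖X N ω‖ ^ 2 ∂P) / (ε ^ 2 * n)) := by
  have hn' : (0 : ℝ) < n := by positivity
  have h1 := mul_meas_ge_le_integral_of_nonneg (μ := P)
    (f := fun ω => ((greedyRecord ε (fun i => X i ω) N).2 : ℝ))
    (ae_of_all _ fun ω => Nat.cast_nonneg _) (integrable_greedyRecord hX.1 ε N) n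
  have h2 := hX.integral_greedyRecord_le hX2 hε N
  refine (measure_mono (t := {ω | (n : ℝ) ≤ ((greedyRecord ε (fun i => X i ω) N).2 : ℝ)})
    fun ω hω => ?_).trans ?_
  · have := OscillatesFrom.add_le_greedyRecord hε (Nat.zero_le N) hω
    simp only [Set.mem_ofPred_eq, Nat.cast_le]
    omega
  · rw [← ofReal_measureReal]
    refine ENNReal.ofReal_le_ofReal ?_
    rw [le_div_iff₀ (by positivity)]
    have : 0 < ε ^ 2 := by positivity
    nlinarith

end DiscreteTime

/-! ### From finite to countable sets of times. -/

/-- The enumeration is frozen after index `N`, so that it is monotone on all of ℕ and can reindex a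
filtration. -/
theorem Finset.exists_strictMonoOn_enumeration {J : Type*} [LinearOrder J] (F : Finset J)
    (hF : F.Nonempty) : ∃ (N : ℕ) (τ : ℕ → J), Monotone τ ∧ StrictMonoOn τ (Set.Iic N) ∧
      τ '' Set.Iic N = F := by
  have hc := hF.card_pos
  have hlt : ∀ k, min k (F.card - 1) < F.card := fun k => by omega
  refine ⟨F.card - 1, fun k => F.orderEmbOfFin rfl ⟨min k (F.card - 1), hlt k⟩, ?_, ?_, ?_⟩
  · intro i j hij
    refine (F.orderEmbOfFin rfl).monotone ?_
    simp only [Fin.mk_le_mk]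
    omega
  · intro i hi j hj hij
    refine (F.orderEmbOfFin rfl).strictMono ?_
    simp only [Set.mem_Iic, Fin.mk_lt_mk] at *
    omega
  · ext x
    rw [← F.range_orderEmbOfFin rfl]
    constructor
    · rintro ⟨k, -, rfl⟩
      exact ⟨_, rfl⟩
    · rintro ⟨k, rfl⟩
      refine ⟨k, by simp only [Set.mem_Iic]; omega, ?_⟩
      simp only
      congr
      omega

/-- A filtration read along an increasing sequence of times. -/
def MeasureTheory.Filtration.compMonotone {Ω J : Type*} [Preorder J] {m : MeasurableSpace Ω}
    (𝓕 : Filtration J m) {τ : ℕ → J} (hτ : Monotone τ) : Filtration ℕ m where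
  seq k := 𝓕 (τ k)
  mono' _ _ h := 𝓕.mono (hτ h)
  le' k := 𝓕.le (τ k)

section ContinuousTime

variable {Ω J E : Type*} {m : MeasurableSpace Ω} {P : Measure Ω} [IsFiniteMeasure P]
  [LinearOrder J] [NormedAddCommGroup E] [InnerProductSpace ℝ E] [CompleteSpace E]
  {𝓕 : Filtration J m} {X : J → Ω → E}

/-- The discrete bound does not depend on the finite set of times, so it survives the increasing
union over finite subsets of `D`. -/
theorem MeasureTheory.Martingale.measure_oscillatesFrom_le (hX : Martingale X 𝓕 P)
    (hX2 : ∀ t, MemLp (X t) 2 P) {C : ℝ} (hC : ∀ t, ∫ ω, ‖X t ω‖ ^ 2 ∂P ≤ C) {D : Set J}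
    (hD : D.Countable) {ε : ℝ} (hε : 0 < ε) {n : ℕ} (hn : n ≠ 0) :
    P {ω | ∃ l, OscillatesFrom (fun t => X t ω) (2 * ε) D n l}
      ≤ ENNReal.ofReal (C / (ε ^ 2 * n)) := by
  classical
  have : Countable D := hD.to_subtype
  let B : Finset D → Set Ω := fun F =>
    {ω | ∃ l, OscillatesFrom (fun t => X t ω) (2 * ε) (Subtype.val '' (F : Set D)) n l}
  have hB : Monotone B := fun F F' h ω => by
    rintro ⟨l, hl⟩
    exact ⟨l, hl.mono (Set.image_mono (Finset.coe_subset.2 h))⟩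
  refine (measure_mono (t := ⋃ F, B F) ?_).trans ?_
  · rintro ω ⟨l, hl⟩
    obtain ⟨F, hF⟩ := hl.exists_finset
    exact Set.mem_iUnion.2 ⟨F, l, hF⟩
  rw [hB.directed_le.measure_iUnion]
  refine iSup_le fun F => ?_
  rcases F.eq_empty_or_nonempty with rfl | hF
  · have : B ∅ = ∅ := by
      ext ω
      simp only [B, Set.mem_ofPred_eq, Set.mem_empty_iff_false, iff_false, not_exists]
      intro l hl
      obtain ⟨k, rfl⟩ := Nat.exists_eq_succ_of_ne_zero hn
      obtain ⟨a, ha, -⟩ := hl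
      simp at ha
    simp [this]
  obtain ⟨N, τ, hτ, hτ', hτF⟩ := (F.map ⟨_, Subtype.val_injective⟩).exists_strictMonoOn_enumeration
    (by simpa using hF)
  have hY : Martingale (fun k => X (τ k)) (𝓕.compMonotone hτ) P :=
    ⟨fun k => hX.1 (τ k), fun i j hij => hX.2 _ _ (hτ hij)⟩
  refine (measure_mono ?_).trans ((hY.measure_oscillatesFrom_Iic_le (fun k => hX2 (τ k)) hε N
    hn).trans (ENNReal.ofReal_le_ofReal ?_))
  · rintro ω ⟨l, hl⟩
    have hA : Subtype.val '' (F : Set D) = τ '' Set.Iic N := by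
      rw [hτF]; simp
    rw [hA] at hl
    -- The time `l` need not be enumerated, but the first interval starts at some `τ i`, hence not
    -- before `τ 0`.
    have hl' : OscillatesFrom (fun t => X t ω) (2 * ε) (τ '' Set.Iic N) n (τ 0) := by
      obtain ⟨k, rfl⟩ := Nat.exists_eq_succ_of_ne_zero hn
      obtain ⟨a, ha, b, hb, -, h⟩ := hl
      obtain ⟨i, hi, rfl⟩ := ha
      exact ⟨_, ⟨i, hi, rfl⟩, b, hb, hτ i.zero_le, h⟩
    exact hl'.comp_strictMonoOn hτ' subset_rfl N.zero_le le_rfl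
  · gcongr
    exact hC _

/-- Almost every path of an `L²`-bounded martingale has only finitely many oscillations of a
given size along a countable set of times. -/
theorem MeasureTheory.Martingale.ae_exists_not_oscillatesFrom (hX : Martingale X 𝓕 P)
    (hX2 : ∀ t, MemLp (X t) 2 P) {C : ℝ} (hC : ∀ t, ∫ ω, ‖X t ω‖ ^ 2 ∂P ≤ C) {D : Set J}
    (hD : D.Countable) :
    ∀ᵐ ω ∂P, ∀ δ > 0, ∃ n, ∀ l, ¬ OscillatesFrom (fun t => X t ω) δ D n l := by
  have key : ∀ k : ℕ, ∀ᵐ ω ∂P, ∃ n, ∀ l,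
      ¬ OscillatesFrom (fun t => X t ω) (2 * (1 / ((k : ℝ) + 1))) D n l := by
    intro k
    have hε : (0 : ℝ) < 1 / ((k : ℝ) + 1) := by positivity
    rw [ae_iff]
    refine le_antisymm ?_ bot_le
    have hlim : Tendsto (fun n : ℕ => ENNReal.ofReal (C / ((1 / ((k : ℝ) + 1)) ^ 2 * n))) atTop
        (𝓝 0) := by
      rw [← ENNReal.ofReal_zero]
      refine ENNReal.tendsto_ofReal (Tendsto.div_atTop tendsto_const_nhds ?_)
      exact tendsto_natCast_atTop_atTop.const_mul_atTop (by positivity)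
    refine ge_of_tendsto hlim ?_
    filter_upwards [eventually_ne_atTop 0] with n hn
    refine (measure_mono fun ω hω => ?_).trans (hX.measure_oscillatesFrom_le hX2 hC hD hε hn)
    simp only [not_exists, not_forall, not_not, Set.mem_ofPred_eq] at hω
    exact hω n
  filter_upwards [ae_all_iff.2 key] with ω hω δ hδ
  obtain ⟨k, hk⟩ := exists_nat_one_div_lt (half_pos hδ)
  obtain ⟨n, hn⟩ := hω k
  refine ⟨n, fun l hl => hn l ?_⟩
  have hk' : 2 * (1 / ((k : ℝ) + 1)) ≤ δ := by linarith
  clear hn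
  induction n generalizing l with
  | zero => trivial
  | succ n ih =>
    obtain ⟨a, ha, b, hb, hla, hab, hd, h⟩ := hl
    exact ⟨a, ha, b, hb, hla, hab, hk'.trans hd, ih b h⟩

end ContinuousTime

/-! ### Limits of conditional expectations. -/

/-- The norm of each conditional expectation is dominated by that of the real variable ‖Z‖, where
the scalar result applies. -/
theorem MeasureTheory.Integrable.uniformIntegrable_condExp_of_normedSpace {Ω ι E : Type*}
    {m : MeasurableSpace Ω} {P : Measure Ω} [IsFiniteMeasure P] [NormedAddCommGroup E]
    [NormedSpace ℝ E] [CompleteSpace E] {Z : Ω → E} (hZ : Integrable Z P)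
    {𝓖 : ι → MeasurableSpace Ω} (h𝓖 : ∀ i, 𝓖 i ≤ m) :
    UniformIntegrable (fun i => P[Z | 𝓖 i]) 1 P := by
  obtain ⟨-, h2, C, hC⟩ := hZ.norm.uniformIntegrable_condExp h𝓖
  have hle : ∀ i, ∀ᵐ ω ∂P, ‖(P[Z | 𝓖 i]) ω‖ ≤ ‖(P[fun ω => ‖Z ω‖ | 𝓖 i]) ω‖ := fun i => by
    filter_upwards [norm_condExp_le (m := 𝓖 i) (μ := P) Z] with ω hω
    exact hω.trans (le_abs_self _)
  refine ⟨fun i => integrable_condExp.aestronglyMeasurable, fun ε hε => ?_, C, fun i =>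
    (eLpNorm_mono_ae (hle i)).trans (hC i)⟩
  obtain ⟨δ, hδ, h⟩ := h2 hε
  refine ⟨δ, hδ, fun i s hs hPs => (eLpNorm_mono_ae ?_).trans (h i s hs hPs)⟩
  filter_upwards [hle i] with ω hω
  by_cases hωs : ω ∈ s <;> simp [hωs] at hω ⊢
  exact hω

section ReverseLimit

variable {Ω E : Type*} {m : MeasurableSpace Ω} {P : Measure Ω} [IsFiniteMeasure P]
  [NormedAddCommGroup E] [NormedSpace ℝ E] [CompleteSpace E]

/-- If the conditional expectations of `Z` given `𝓖 n ⊇ 𝓗` converge almost surely to an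
`𝓗`-measurable limit, then the limit is the conditional expectation of `Z` given `𝓗`. -/
theorem ae_eq_condExp_of_tendsto_condExp {Z : Ω → E} (hZ : Integrable Z P)
    {𝓗 : MeasurableSpace Ω} {𝓖 : ℕ → MeasurableSpace Ω} (h𝓖 : ∀ n, 𝓖 n ≤ m) (h𝓗 : ∀ n, 𝓗 ≤ 𝓖 n)
    {R : Ω → E} (hR : StronglyMeasurable[𝓗] R)
    (hlim : ∀ᵐ ω ∂P, Tendsto (fun n => (P[Z | 𝓖 n]) ω) atTop (𝓝 (R ω))) :
    R =ᵐ[P] P[Z | 𝓗] := by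
  have hm : 𝓗 ≤ m := (h𝓗 0).trans (h𝓖 0)
  have hUI := hZ.uniformIntegrable_condExp_of_normedSpace h𝓖
  have hRint : Integrable R P := hUI.integrable_of_ae_tendsto hlim
  have h1 : Tendsto (fun n => eLpNorm (P[Z | 𝓖 n] - R) 1 P) atTop (𝓝 0) :=
    tendsto_Lp_finite_of_tendsto_ae le_rfl ENNReal.one_ne_top hUI.1
      (memLp_one_iff_integrable.2 hRint) hUI.2.1 hlim
  -- Conditioning on `𝓗` contracts L¹, fixes `R`, and sends `P[Z | 𝓖 n]` to `P[Z | 𝓗]` by the tower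
  -- property.
  have h2 : ∀ n, eLpNorm (P[Z | 𝓗] - R) 1 P ≤ eLpNorm (P[Z | 𝓖 n] - R) 1 P := by
    intro n
    refine le_trans (le_of_eq (eLpNorm_congr_ae ?_))
      (eLpNorm_condExp_le_eLpNorm (m := 𝓗) (P[Z | 𝓖 n] - R) le_rfl)
    refine EventuallyEq.symm ((condExp_sub integrable_condExp hRint 𝓗).trans ?_)
    rw [condExp_of_stronglyMeasurable hm hR hRint]
    exact (condExp_condExp_of_le (h𝓗 n) (h𝓖 n)).sub EventuallyEq.rfl
  have h3 : eLpNorm (P[Z | 𝓗] - R) 1 P = 0 :=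
    le_antisymm (ge_of_tendsto' h1 h2) bot_le
  rw [eLpNorm_eq_zero_iff (integrable_condExp.sub hRint).aestronglyMeasurable one_ne_zero] at h3
  filter_upwards [h3] with ω hω
  exact (sub_eq_zero.1 hω).symm

end ReverseLimit

/-! ### The càdlàg modification. -/

section RightLimits

variable {J E : Type*} [LinearOrder J] [TopologicalSpace J]

open Classical in
/-- The right limit of `f` at `t` along `D`, and `f t` at a maximal element `t`. -/
noncomputable def rightLimAlong [TopologicalSpace E] [Nonempty E] (D : Set J) (f : J → E)
    (t : J) : E :=
  if ∃ u, t < u then limUnder (𝓝[Set.Ioi t ∩ D] t) f else f t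

variable [PseudoMetricSpace E] [CompleteSpace E] [Nonempty E]

theorem tendsto_rightLimAlong [OrderTopology J] [DenselyOrdered J] {f : J → E} {D : Set J}
    (hD : Dense D) (hf : ∀ δ > 0, ∃ n, ∀ l, ¬ OscillatesFrom f δ D n l) {t : J}
    (ht : ∃ u, t < u) : Tendsto f (𝓝[Set.Ioi t ∩ D] t) (𝓝 (rightLimAlong D f t)) := by
  have := hD.nhdsWithin_Ioi_inter_neBot ht
  rw [rightLimAlong, if_pos ht]
  exact tendsto_nhds_limUnder (CompleteSpace.complete (cauchy_map_nhdsGT_inter hf))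

theorem isCadlagPath_rightLimAlong [OrderTopology J] [DenselyOrdered J] {f : J → E} {D : Set J}
    (hD : Dense D) (hf : ∀ δ > 0, ∃ n, ∀ l, ¬ OscillatesFrom f δ D n l) :
    IsCadlagPath (rightLimAlong D f) := by
  refine isCadlagPath_of_tendsto_nhdsGT_inter hD (fun t => tendsto_rightLimAlong hD hf) fun t => ?_
  by_cases h : (𝓝[Set.Iio t ∩ D] t).NeBot
  · exact CompleteSpace.complete (cauchy_map_nhdsLT_inter hf)
  · rw [not_neBot] at h
    exact ⟨Classical.arbitrary E, by simp [h]⟩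

end RightLimits

/-- The martingale closed by a square integrable random variable with values in a Hilbert space
has a càdlàg modification, if the filtration satisfies the usual conditions. -/
theorem exists_cadlag_modification_condExp {Ω J E : Type*} {m : MeasurableSpace Ω}
    {P : Measure Ω} [IsFiniteMeasure P]
    [NormedAddCommGroup E] [InnerProductSpace ℝ E] [CompleteSpace E] [SecondCountableTopology E]
    [LinearOrder J] [TopologicalSpace J] [OrderTopology J] [DenselyOrdered J]
    [SecondCountableTopology J] {𝓕 : Filtration J m}
    (hright : ∀ t, (∃ u, t < u) → ∀ s, (∀ u, t < u → MeasurableSet[𝓕 u] s) → MeasurableSet[𝓕 t] s)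
    (hnull : ∀ t s, P s = 0 → MeasurableSet[𝓕 t] s) {Z : Ω → E} (hZ : MemLp Z 2 P) :
    ∃ X : J → Ω → E, (∀ ω, IsCadlagPath fun t => X t ω) ∧ StronglyAdapted 𝓕 X ∧
      ∀ t, X t =ᵐ[P] P[Z | 𝓕 t] := by
  classical
  obtain ⟨D, hDc, hD⟩ := TopologicalSpace.exists_countable_dense J
  have hZ1 : Integrable Z P := hZ.integrable one_le_two
  let Y : J → Ω → E := fun t => P[Z | 𝓕 t]
  have hY : Martingale Y 𝓕 P := martingale_condExp Z 𝓕 P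
  have hYC : ∀ t, ∫ ω, ‖Y t ω‖ ^ 2 ∂P ≤ ∫ ω, ‖Z ω‖ ^ 2 ∂P := fun t => by
    have h := integral_norm_condExp_rpow_le (m := 𝓕 t) (μ := P) (p := 2) one_le_two (f := Z)
      (by simpa using hZ.integrable_norm_pow two_ne_zero)
    simpa using h
  let Good : Set Ω := {ω | ∀ δ > 0, ∃ n, ∀ l, ¬ OscillatesFrom (fun t => Y t ω) δ D n l}
  have hGood : ∀ᵐ ω ∂P, ω ∈ Good :=
    hY.ae_exists_not_oscillatesFrom (fun t => hZ.condExp one_le_two) hYC hDc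
  -- The exceptional set depends on the whole path, yet it is null and so belongs to every `𝓕 t`;
  -- redefining paths on it keeps adaptedness.
  have hGoodm : ∀ t, MeasurableSet[𝓕 t] Good := fun t =>
    MeasurableSet.of_compl (hnull t _ (mem_ae_iff.1 hGood))
  let X : J → Ω → E := fun t ω => if ω ∈ Good then rightLimAlong D (fun t => Y t ω) t else 0
  have hX_good : ∀ t, ∀ ω ∈ Good, X t ω = rightLimAlong D (fun t => Y t ω) t :=
    fun t ω hω => if_pos hω
  have hX_bad : ∀ t, ∀ ω ∉ Good, X t ω = 0 := fun t ω hω => if_neg hω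
  have hXm : ∀ t, StronglyMeasurable[𝓕 t] (X t) := by
    intro t
    by_cases ht : ∃ u, t < u
    · have := hD.nhdsWithin_Ioi_inter_neBot ht
      obtain ⟨σ, hσ⟩ := exists_seq_tendsto (𝓝[Set.Ioi t ∩ D] t)
      -- Times of `D` decreasing to `t` are eventually below any `u > t`, so the limit is `𝓕
      -- u`-measurable for all such `u`; right continuity then gives `𝓕 t`.
      have hu : ∀ u, t < u → StronglyMeasurable[𝓕 u] (X t) := by
        intro u htu
        have hev : ∀ᶠ n in atTop, σ n < u := by
          filter_upwards [hσ (mem_nhdsWithin_of_mem_nhds (Iio_mem_nhds htu))] with n hn using hn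
        obtain ⟨N, hN⟩ := eventually_atTop.1 hev
        refine stronglyMeasurable_of_tendsto (m := 𝓕 u) atTop
          (f := fun n => Good.indicator (Y (σ (n + N))))
          (fun n => StronglyMeasurable.indicator
            ((hY.1 _).mono (𝓕.mono (hN _ (Nat.le_add_left N n)).le)) (hGoodm u)) ?_
        rw [tendsto_pi_nhds]
        intro ω
        by_cases hω : ω ∈ Good
        · simp only [Set.indicator_of_mem hω, hX_good t ω hω]
          exact (((tendsto_rightLimAlong hD hω ht).comp hσ).comp (tendsto_add_atTop_nat N))
        · simp only [Set.indicator_of_notMem hω, hX_bad t ω hω]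
          exact tendsto_const_nhds
      borelize E
      exact Measurable.stronglyMeasurable fun B hB =>
        hright t ht _ fun u htu => (hu u htu).measurable hB
    · have : X t = Good.indicator (Y t) := by
        ext ω
        by_cases hω : ω ∈ Good
        · rw [hX_good t ω hω, rightLimAlong, if_neg ht, Set.indicator_of_mem hω]
        · rw [hX_bad t ω hω, Set.indicator_of_notMem hω]
      rw [this]
      exact (hY.1 t).indicator (hGoodm t)
  refine ⟨X, fun ω => ?_, hXm, fun t => ?_⟩
  · by_cases hω : ω ∈ Good
    · simp only [hX_good _ ω hω]
      exact isCadlagPath_rightLimAlong hD hω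
    · simp only [hX_bad _ ω hω]
      exact fun t => ⟨continuousWithinAt_const, 0, tendsto_const_nhds⟩
  · by_cases ht : ∃ u, t < u
    · have := hD.nhdsWithin_Ioi_inter_neBot ht
      obtain ⟨σ, hσ⟩ := exists_seq_tendsto (𝓝[Set.Ioi t ∩ D] t)
      obtain ⟨N, hN⟩ := eventually_atTop.1 (hσ self_mem_nhdsWithin)
      refine ae_eq_condExp_of_tendsto_condExp hZ1 (𝓖 := fun n => 𝓕 (σ (n + N)))
        (fun n => 𝓕.le _) (fun n => 𝓕.mono (le_of_lt (hN _ (Nat.le_add_left N n)).1)) (hXm t) ?_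
      filter_upwards [hGood] with ω hω
      rw [hX_good t ω hω]
      exact ((tendsto_rightLimAlong hD hω ht).comp hσ).comp (tendsto_add_atTop_nat N)
    · filter_upwards [hGood] with ω hω
      rw [hX_good t ω hω, rightLimAlong, if_neg ht]

/-! ### Hilbert-Schmidt operators and radonification. -/

/-- The adjoint of a Hilbert-Schmidt operator is Hilbert-Schmidt, in any complete orthonormal
system. -/
theorem IsHilbertSchmidt.summable_norm_adjoint_sq {H : Type u} {G κ : Type*}
    [NormedAddCommGroup H] [InnerProductSpace ℝ H] [CompleteSpace H] [NormedAddCommGroup G]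
    [InnerProductSpace ℝ G] [CompleteSpace G] {S : H →L[ℝ] G} (hS : IsHilbertSchmidt S)
    (b : HilbertBasis κ ℝ G) : Summable fun k => ‖ContinuousLinearMap.adjoint S (b k)‖ ^ 2 := by
  obtain ⟨ι, e, he⟩ := hS
  have h1 : ∀ i, HasSum (fun k => inner ℝ (S (e i)) (b k) ^ 2) (‖S (e i)‖ ^ 2) := fun i => by
    have h := b.hasSum_inner_mul_inner (S (e i)) (S (e i))
    rw [real_inner_self_eq_norm_sq] at h
    convert! h using 2 with k
    rw [sq, real_inner_comm (S (e i)) (b k)]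
  have h2 : ∀ k, HasSum (fun i => inner ℝ (S (e i)) (b k) ^ 2)
      (‖ContinuousLinearMap.adjoint S (b k)‖ ^ 2) := fun k => by
    have h := e.hasSum_inner_mul_inner (ContinuousLinearMap.adjoint S (b k))
      (ContinuousLinearMap.adjoint S (b k))
    rw [real_inner_self_eq_norm_sq] at h
    convert! h using 2 with i
    rw [ContinuousLinearMap.adjoint_inner_left, ContinuousLinearMap.adjoint_inner_right, sq,
      real_inner_comm (S (e i)) (b k)]
  -- Both sums of squared norms are iterated sums of the same squared matrix coefficients, so
  -- Tonelli exchanges them.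
  have h3 : Summable fun p : ι × κ => inner ℝ (S (e p.1)) (b p.2) ^ 2 := by
    rw [summable_prod_of_nonneg fun p => sq_nonneg _]
    refine ⟨fun i => (h1 i).summable, ?_⟩
    simpa only [(h1 _).tsum_eq] using he
  have h4 := (summable_prod_of_nonneg (f := fun p : κ × ι => inner ℝ (S (e p.2)) (b p.1) ^ 2)
    fun p => sq_nonneg _).1 ((Equiv.prodComm κ ι).summable_iff.2 h3)
  simpa only [(h2 _).tsum_eq] using h4.2

section Radonify

variable {Ω G : Type*} {m : MeasurableSpace Ω} {P : Measure Ω}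
  [NormedAddCommGroup G] [InnerProductSpace ℝ G]

/-- Multiplication of square integrable random variables by a fixed unit vector. -/
noncomputable def lpSMulUnit (P : Measure Ω) (g : G) (hg : ‖g‖ = 1) :
    Lp ℝ 2 P →ₗᵢ[ℝ] Lp G 2 P :=
  LinearMap.isometryOfInner ((ContinuousLinearMap.toSpanSingleton ℝ g).compLpₗ 2 P) fun x y => by
    rw [L2.inner_def, L2.inner_def]
    refine integral_congr_ae ?_
    filter_upwards [(ContinuousLinearMap.toSpanSingleton ℝ g).coeFn_compLp x,
      (ContinuousLinearMap.toSpanSingleton ℝ g).coeFn_compLp y] with ω hx hy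
    simp only [ContinuousLinearMap.compLpₗ_apply]
    rw [hx, hy]
    simp [inner_smul_left, inner_smul_right, hg, mul_comm]

theorem coeFn_lpSMulUnit {g : G} (hg : ‖g‖ = 1) (x : Lp ℝ 2 P) :
    ∀ᵐ ω ∂P, lpSMulUnit P g hg x ω = x ω • g := by
  filter_upwards [(ContinuousLinearMap.toSpanSingleton ℝ g).coeFn_compLp x] with ω hx
  exact hx

/-- A continuous linear map from a Hilbert space to `L²` whose norms along a complete orthonormal
system are square summable is given by a square integrable random vector. -/
theorem exists_lp_inner_eq_of_summable_norm_sq [CompleteSpace G] {κ : Type*}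
    (b : HilbertBasis κ ℝ G) (A : G →L[ℝ] Lp ℝ 2 P) (hA : Summable fun k => ‖A (b k)‖ ^ 2) :
    ∃ Z : Lp G 2 P, ∀ g, ∀ᵐ ω ∂P, inner ℝ (Z ω) g = A g ω := by
  -- The subspaces L²·b_k of L²(Ω; G) are mutually orthogonal, so ∑ A(b_k) b_k converges exactly
  -- when the squared norms are summable.
  have hV : OrthogonalFamily ℝ (fun _ : κ => Lp ℝ 2 P)
      fun k => lpSMulUnit P (b k) (b.orthonormal.1 k) := by
    intro i j hij x y
    rw [L2.inner_def]
    refine integral_eq_zero_of_ae ?_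
    filter_upwards [coeFn_lpSMulUnit (b.orthonormal.1 i) x,
      coeFn_lpSMulUnit (b.orthonormal.1 j) y] with ω hx hy
    rw [hx, hy]
    simp [inner_smul_left, inner_smul_right, b.orthonormal.2 hij]
  obtain ⟨Z, hZ⟩ := (hV.summable_iff_norm_sq_summable fun k => A (b k)).2 hA
  refine ⟨Z, fun g => ?_⟩
  have h1 := ((innerSL ℝ g).compLpL 2 P).hasSum hZ
  have h2 := A.hasSum (b.hasSum_repr g)
  have h3 : ∀ k, (innerSL ℝ g).compLpL 2 P (lpSMulUnit P (b k) (b.orthonormal.1 k) (A (b k)))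
      = A (b.repr g k • b k) := by
    intro k
    rw [map_smul]
    refine Lp.ext ?_
    filter_upwards [(innerSL ℝ g).coeFn_compLpL
        (lpSMulUnit P (b k) (b.orthonormal.1 k) (A (b k))),
      coeFn_lpSMulUnit (b.orthonormal.1 k) (A (b k)), Lp.coeFn_smul (b.repr g k) (A (b k))]
      with ω e1 e2 e3
    rw [e1, e2, e3, b.repr_apply_apply]
    simp [real_inner_comm, mul_comm]
  simp only [h3] at h1
  have h4 := h1.unique h2
  filter_upwards [(innerSL ℝ g).coeFn_compLpL (p := 2) Z] with ω hω
  rw [← h4, hω, innerSL_apply_apply, real_inner_comm]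

end Radonify

/-- A continuous cylindrical random variable with square integrable values is continuous
into `L²`. -/
theorem CylindricalRV.IsContinuous.exists_clm_lp {Ω H : Type*} {m : MeasurableSpace Ω}
    {P : Measure Ω} [NormedAddCommGroup H] [InnerProductSpace ℝ H] [CompleteSpace H]
    {Y : CylindricalRV H P} (hY : Y.IsContinuous) (hY2 : ∀ h, MemLp (Y h) 2 P) :
    ∃ B : H →L[ℝ] Lp ℝ 2 P, ∀ h, ∀ᵐ ω ∂P, B h ω = Y h ω := by
  let B₀ : H →ₗ[ℝ] Lp ℝ 2 P :=
    { toFun := fun h => (hY2 h).toLp _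
      map_add' := fun h k => by
        refine Lp.ext ?_
        filter_upwards [(hY2 (h + k)).coeFn_toLp, Lp.coeFn_add ((hY2 h).toLp _) ((hY2 k).toLp _),
          (hY2 h).coeFn_toLp, (hY2 k).coeFn_toLp, AEEqFun.coeFn_add (Y h) (Y k)]
          with ω e1 e2 e3 e4 e5
        rw [e1, e2, map_add, e5, Pi.add_apply, Pi.add_apply, e3, e4]
      map_smul' := fun c h => by
        refine Lp.ext ?_
        filter_upwards [(hY2 (c • h)).coeFn_toLp, Lp.coeFn_smul c ((hY2 h).toLp _),
          (hY2 h).coeFn_toLp, AEEqFun.coeFn_smul c (Y h)] with ω e1 e2 e3 e4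
        rw [e1, RingHom.id_apply, e2, map_smul, e4, Pi.smul_apply, Pi.smul_apply, e3] }
  have hB₀ : ∀ h, B₀ h =ᵐ[P] Y h := fun h => (hY2 h).coeFn_toLp
  -- Closed graph: L² convergence of the images and continuity in probability both give limits in
  -- measure, and these are a.e. unique.
  refine ⟨⟨B₀, B₀.continuous_of_seq_closed_graph fun x h y hx hxy => ?_⟩, hB₀⟩
  refine Lp.ext ?_
  have h1 : TendstoInMeasure P (fun n ω => Y (x n) ω) atTop y :=
    (tendstoInMeasure_of_tendsto_Lp hxy).congr_left fun n => hB₀ (x n)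
  have h2 : TendstoInMeasure P (fun n ω => Y (x n) ω) atTop (Y h) := (hY h).comp hx
  exact (tendstoInMeasure_ae_unique h1 h2).trans (hB₀ h).symm

theorem UsualConditions.measurableSet_restrictIcc {Ω : Type*} {m : MeasurableSpace Ω}
    {P : Measure Ω} {𝓕 : Filtration ℝ≥0 m} (h𝓕 : UsualConditions 𝓕 P) {T : ℝ≥0}
    (t : Set.Icc (0 : ℝ≥0) T) (ht : ∃ u, t < u) (s : Set Ω)
    (hs : ∀ u, t < u → MeasurableSet[𝓕.restrictIcc T u] s) :
    MeasurableSet[𝓕.restrictIcc T t] s := by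
  have := h𝓕.rightContinuous
  refine Filtration.IsRightContinuous.measurableSet (𝓕 := 𝓕) (i := (t : ℝ≥0)) ?_
  rw [Filtration.rightCont_eq]
  simp only [MeasurableSpace.measurableSet_iInf]
  intro u hu
  obtain ⟨v, hv⟩ := ht
  -- A time `u > t` may exceed `T`; truncating it at `T` keeps it above `t` because `t` is not
  -- maximal.
  have hlt : t < (⟨min u T, zero_le, min_le_right _ _⟩ : Set.Icc (0 : ℝ≥0) T) :=
    lt_min hu (lt_of_lt_of_le hv v.2.2)
  exact 𝓕.mono (min_le_left u T) _ (hs _ hlt)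

/-! ### Assembly of the version. -/

theorem mainTheorem2 {Ω : Type*} {m : MeasurableSpace Ω} (P : Measure Ω) [IsProbabilityMeasure P]
    [P.IsComplete] (𝓕 : Filtration ℝ≥0 m) (h𝓕 : UsualConditions 𝓕 P)
    {H : Type*} [NormedAddCommGroup H] [InnerProductSpace ℝ H] [CompleteSpace H]
    [TopologicalSpace.SeparableSpace H]
    {G : Type*} [NormedAddCommGroup G] [InnerProductSpace ℝ G] [CompleteSpace G]
    [TopologicalSpace.SeparableSpace G]
    (T : ℝ≥0) (hT : 0 < T)
    (M : Set.Icc (0 : ℝ≥0) T → CylindricalRV H P)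
    (hM : IsCylindricalSquareIntegrableMartingale M (𝓕.restrictIcc T))
    (hMcont : ∀ t, (M t).IsContinuous)
    (S : H →L[ℝ] G) (hS : IsHilbertSchmidt S) :
    IsCylindricalSquareIntegrableMartingale (cylindricalCompAdjoint M S) (𝓕.restrictIcc T) ∧
    ∃ X : Set.Icc (0 : ℝ≥0) T → Ω → G,
      IsVersionOf X (cylindricalCompAdjoint M S) ∧
      (∀ ω, IsCadlagPath fun t => X t ω) ∧
      IsSquareIntegrableMartingale X (𝓕.restrictIcc T) P := by
  refine ⟨fun g => hM (ContinuousLinearMap.adjoint S g), ?_⟩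
  have : SecondCountableTopology G := UniformSpace.secondCountable_of_separable G
  let τ : Set.Icc (0 : ℝ≥0) T := ⟨T, hT.le, le_rfl⟩
  obtain ⟨B, hB⟩ := (hMcont τ).exists_clm_lp fun h => (hM h).2 τ
  obtain ⟨w, b, -⟩ := exists_hilbertBasis ℝ G
  obtain ⟨Z, hZ⟩ := exists_lp_inner_eq_of_summable_norm_sq b
    (B.comp (ContinuousLinearMap.adjoint S)) (by
      refine Summable.of_nonneg_of_le (fun k => by positivity) (fun k => ?_)
        ((hS.summable_norm_adjoint_sq b).mul_left (‖B‖ ^ 2))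
      rw [← mul_pow]
      gcongr
      exact B.le_opNorm _)
  have hZ2 : MemLp Z 2 P := Lp.memLp Z
  have hZ1 : Integrable Z P := hZ2.integrable one_le_two
  obtain ⟨X, hXcad, hXad, hXZ⟩ := exists_cadlag_modification_condExp (𝓕 := 𝓕.restrictIcc T)
    h𝓕.measurableSet_restrictIcc
    (fun t s hs => 𝓕.mono (zero_le (a := (t : ℝ≥0))) _ (h𝓕.null_measurable s hs)) hZ2
  refine ⟨X, fun t g => ?_, hXcad, ⟨hXad, fun s t hst => ?_⟩, fun t =>
    (hZ2.condExp one_le_two).ae_eq (hXZ t).symm⟩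
  -- ⟨E[Z | F_t], g⟩ = E[⟨Z, g⟩ | F_t] = E[M_T(S*g) | F_t] = M_t(S*g).
  · have h1 := (innerSL ℝ g).comp_condExp_comm (m := 𝓕.restrictIcc T t) hZ1
    have h2 : innerSL ℝ g ∘ Z =ᵐ[P] fun ω => M τ (ContinuousLinearMap.adjoint S g) ω := by
      filter_upwards [hZ g, hB (ContinuousLinearMap.adjoint S g)] with ω e1 e2
      rw [Function.comp_apply, innerSL_apply_apply, real_inner_comm, e1]
      exact e2
    filter_upwards [h1, condExp_congr_ae (m := 𝓕.restrictIcc T t) h2,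
      (hM (ContinuousLinearMap.adjoint S g)).1.2 t τ t.2.2, hXZ t] with ω e1 e2 e3 e4
    rw [e4, real_inner_comm]
    exact e1.trans (e2.trans e3)
  · exact (condExp_congr_ae (hXZ t)).trans
      ((condExp_condExp_of_le ((𝓕.restrictIcc T).mono hst) ((𝓕.restrictIcc T).le t)).trans
        (hXZ s).symm)
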